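/- Let $X$ be a real Banach lattice with order continuous norm, i.e. such that $\inf\{\|x\| : x\in A\}=0$ for every nonempty downward directed set $A\subset X$ with infimum $0$ (equivalently, $\|x_\alpha\|\to 0$ for every net $x_\alpha\downarrow 0$ in $X$). Let $\varepsilon>0$, and let $T:X\to X$ be a linear map (not assumed bounded) which is $\varepsilon$-band preserving, i.e. for every $x\in X$, $$\sup\{\,\||Tx|\wedge y\| : y\in X,\ y\ge 0,\ y\perp x\,\}\le \varepsilon\|x\|,$$ where $y\perp x$ means $|y|\wedge|x|=0$. Then $T$ is continuous. -/

import Mathlib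

namespace BanachLattice

/-- Two elements of a vector lattice are disjoint, `x ⊥ y`, if `|x| ∧ |y| = 0`. -/
def IsDisjoint {X : Type*} [Lattice X] [AddCommGroup X] (x y : X) : Prop :=
  |x| ⊓ |y| = 0

/-- A normed lattice is order continuous if `inf {‖x‖ : x ∈ A} = 0` for every nonempty downward
directed set `A` with `inf A = 0`; equivalently, `‖x_α‖ → 0` for every net `x_α ↓ 0`
(along such a net the norms decrease). -/
def IsOrderContinuous (X : Type*) [NormedAddCommGroup X] [Lattice X] : Prop :=
  ∀ A : Set X, A.Nonempty → DirectedOn (fun x y => y ≤ x) A → IsGLB A 0 →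
    IsGLB (norm '' A) 0

/-- A linear map `T : X → X` is `ε`-band preserving if, for every `x`,
`sup {‖|T x| ∧ y‖ : y ≥ 0, y ⊥ x} ≤ ε ‖x‖`, i.e. each member of the set is at most `ε ‖x‖`. -/
def IsEpsBandPreserving {X : Type*} [NormedAddCommGroup X] [NormedSpace ℝ X] [Lattice X]
    (ε : ℝ) (T : X →ₗ[ℝ] X) : Prop :=
  ∀ x y : X, 0 ≤ y → IsDisjoint y x → ‖|T x| ⊓ y‖ ≤ ε * ‖x‖

end BanachLattice

/-! By the closed graph theorem it is enough that `x n → 0` and `T (x n) → y` force `y = 0`. Order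
continuity yields contractive band projections `P` onto `u^⊥⊥`, and `T P - P T` is bounded by the
`ε`-condition, so `P y` is again such a limit, along a null sequence in the band
(`exists_seq_principalBand`). Let `y ≠ 0`. If `|y|` dominates an atom, its band is a line, where `T`
is continuous, so that component of `y` vanishes, which is absurd. Otherwise `|y|` dominates
infinitely many disjoint `u k > 0`, and a gliding hump (`false_of_disjoint_seq`) sums small vectors
from their bands to some `s` with `‖T s‖` exceeding every bound. -/

namespace BanachLattice

/-! ### Disjointness in lattice-ordered groups -/

section LatticeGroup

theorem IsDisjoint.symm {X : Type*} [Lattice X] [AddCommGroup X] {x y : X}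
    (h : IsDisjoint x y) : IsDisjoint y x := by
  rwa [IsDisjoint, inf_comm]

variable {X : Type*} [Lattice X] [AddCommGroup X] [IsOrderedAddMonoid X]

theorem inf_add_le_inf_add_inf {a b c : X} (ha : 0 ≤ a) (hb : 0 ≤ b) (hc : 0 ≤ c) :
    a ⊓ (b + c) ≤ a ⊓ b + a ⊓ c := by
  rw [add_inf, inf_add, inf_add]
  refine le_inf (le_inf ?_ ?_) (le_inf ?_ inf_le_right)
  · exact inf_le_left.trans (le_add_of_nonneg_right ha)
  · exact inf_le_left.trans (le_add_of_nonneg_left hb)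
  · exact inf_le_left.trans (le_add_of_nonneg_right hc)

theorem isDisjoint_of_nonneg {x y : X} (hx : 0 ≤ x) (hy : 0 ≤ y) :
    IsDisjoint x y ↔ x ⊓ y = 0 := by
  rw [IsDisjoint, abs_of_nonneg hx, abs_of_nonneg hy]

theorem isDisjoint_zero_left (y : X) : IsDisjoint 0 y := by
  simp [IsDisjoint]

theorem isDisjoint_abs_left {x y : X} : IsDisjoint |x| y ↔ IsDisjoint x y := by
  rw [IsDisjoint, abs_abs, IsDisjoint]

theorem isDisjoint_self {x : X} : IsDisjoint x x ↔ x = 0 := by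
  rw [IsDisjoint, inf_idem]
  refine ⟨fun h => le_antisymm ?_ ?_, fun h => by simp [h]⟩
  · exact (le_abs_self x).trans h.le
  · exact neg_nonpos.1 ((neg_le_abs x).trans h.le)

theorem IsDisjoint.mono_left {x y z : X} (h : IsDisjoint y z) (hxy : |x| ≤ |y|) :
    IsDisjoint x z :=
  le_antisymm ((inf_le_inf_right _ hxy).trans h.le) (le_inf (abs_nonneg _) (abs_nonneg _))

theorem IsDisjoint.add_left {x y z : X} (hx : IsDisjoint x z) (hy : IsDisjoint y z) :
    IsDisjoint (x + y) z := by
  refine le_antisymm ?_ (le_inf (abs_nonneg _) (abs_nonneg _))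
  calc |x + y| ⊓ |z| ≤ (|x| + |y|) ⊓ |z| := inf_le_inf_right _ (abs_add_le x y)
    _ = |z| ⊓ (|x| + |y|) := inf_comm _ _
    _ ≤ |z| ⊓ |x| + |z| ⊓ |y| :=
      inf_add_le_inf_add_inf (abs_nonneg _) (abs_nonneg _) (abs_nonneg _)
    _ = 0 := by rw [show |z| ⊓ |x| = 0 from hx.symm, show |z| ⊓ |y| = 0 from hy.symm, add_zero]

theorem IsDisjoint.nsmul_left {x z : X} (hx : IsDisjoint x z) (n : ℕ) :
    IsDisjoint (n • x) z := by
  induction n with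
  | zero => simpa using isDisjoint_zero_left z
  | succ n ih => rw [succ_nsmul]; exact ih.add_left hx

/-- Adding a disjoint element does not decrease the absolute value. -/
theorem IsDisjoint.abs_le_abs_add {x y : X} (h : IsDisjoint x y) : |x| ≤ |x + y| := by
  have h1 : |x| ≤ |x + y| + |y| := by
    simpa using abs_add_le (x + y) (-y)
  calc |x| = |x| ⊓ (|x + y| + |y|) := (inf_eq_left.2 h1).symm
    _ ≤ |x| ⊓ |x + y| + |x| ⊓ |y| :=
      inf_add_le_inf_add_inf (abs_nonneg _) (abs_nonneg _) (abs_nonneg _)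
    _ = |x| ⊓ |x + y| := by rw [show |x| ⊓ |y| = 0 from h, add_zero]
    _ ≤ |x + y| := inf_le_right

theorem not_isDisjoint_of_le_abs {u y : X} (hu : 0 < u) (huy : u ≤ |y|) : ¬ IsDisjoint y u := by
  intro h
  rw [IsDisjoint, abs_of_nonneg hu.le, inf_eq_right.2 huy] at h
  exact hu.ne' h

end LatticeGroup

theorem IsEpsBandPreserving.norm_le {X : Type*} [NormedAddCommGroup X] [NormedSpace ℝ X]
    [Lattice X] [IsOrderedAddMonoid X] [HasSolidNorm X] {ε : ℝ} {T : X →ₗ[ℝ] X}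
    (hT : IsEpsBandPreserving ε T) {x y : X} (hy : IsDisjoint y x) (hle : |y| ≤ |T x|) : ‖y‖ ≤ ε * ‖x‖ := by
  have := hT x |y| (abs_nonneg y) (isDisjoint_abs_left.2 hy)
  rwa [inf_eq_right.2 hle, norm_abs_eq_norm] at this

/-! ### Disjoint complements and principal bands -/

variable {X : Type*} [NormedAddCommGroup X] [NormedSpace ℝ X]
    [Lattice X] [IsOrderedAddMonoid X] [IsOrderedModule ℝ X]

theorem IsDisjoint.smul_left {x z : X} (hx : IsDisjoint x z) (t : ℝ) : IsDisjoint (t • x) z := by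
  obtain ⟨n, hn⟩ := exists_nat_ge |t|
  refine (isDisjoint_abs_left.2 hx |>.nsmul_left n).mono_left ?_
  have h1 : ∀ s : ℝ, |s| ≤ n → s • x ≤ n • |x| := by
    intro s hs
    rw [← Nat.cast_smul_eq_nsmul ℝ]
    rcases le_total 0 s with h | h
    · rw [abs_of_nonneg h] at hs
      exact (smul_le_smul_of_nonneg_left (le_abs_self x) h).trans
        (smul_le_smul_of_nonneg_right hs (abs_nonneg x))
    · rw [abs_of_nonpos h] at hs
      have := (smul_le_smul_of_nonneg_left (neg_le_abs x) (neg_nonneg.2 h)).trans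
        (smul_le_smul_of_nonneg_right hs (abs_nonneg x))
      simpa using this
  rw [abs_of_nonneg (nsmul_nonneg (abs_nonneg x) n)]
  refine abs_le'.2 ⟨h1 t hn, ?_⟩
  rw [← neg_smul]
  exact h1 (-t) (by rwa [abs_neg])

/-- The disjoint complement `S^⊥` of a set, as a subspace. -/
def disjointComplement (S : Set X) : Submodule ℝ X where
  carrier := {x | ∀ s ∈ S, IsDisjoint x s}
  zero_mem' s _ := isDisjoint_zero_left s
  add_mem' hx hy s hs := (hx s hs).add_left (hy s hs)
  smul_mem' t _ hx s hs := (hx s hs).smul_left t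

theorem mem_disjointComplement {S : Set X} {x : X} :
    x ∈ disjointComplement S ↔ ∀ s ∈ S, IsDisjoint x s := Iff.rfl

/-- The band `u^⊥⊥` generated by an element. -/
def principalBand (u : X) : Submodule ℝ X :=
  disjointComplement (disjointComplement {u} : Set X)

theorem mem_disjointComplement_singleton {u x : X} :
    x ∈ disjointComplement {u} ↔ IsDisjoint x u := by
  simp [mem_disjointComplement]

theorem mem_principalBand {u x : X} :
    x ∈ principalBand u ↔ ∀ v, IsDisjoint v u → IsDisjoint x v := by
  simp [principalBand, mem_disjointComplement]

theorem self_mem_principalBand (u : X) : u ∈ principalBand u :=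
  mem_principalBand.2 fun _ hv => hv.symm

variable [HasSolidNorm X]

theorem isClosed_disjointComplement (S : Set X) :
    IsClosed (disjointComplement S : Set X) := by
  have : (disjointComplement S : Set X) = ⋂ s ∈ S, {x | |x| ⊓ |s| = 0} := by
    ext x
    simp [mem_disjointComplement, IsDisjoint]
  rw [this]
  refine isClosed_biInter fun s _ => isClosed_eq ?_ continuous_const
  have : Continuous fun x : X => |x| := continuous_id.sup continuous_neg
  exact this.inf continuous_const

/-- Archimedean property: `w ≤ z / (n + 1) → 0`, and the order is closed. -/
theorem nonpos_of_nsmul_le {w z : X} (h : ∀ n : ℕ, n • w ≤ z) : w ≤ 0 := by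
  have hlim : Filter.Tendsto (fun n : ℕ => ((1 : ℝ) / ((n : ℝ) + 1)) • z) Filter.atTop
      (nhds 0) := by
    simpa using (tendsto_one_div_add_atTop_nhds_zero_nat (𝕜 := ℝ)).smul_const z
  refine ge_of_tendsto' hlim fun n => ?_
  have hpos : (0 : ℝ) < (n : ℝ) + 1 := by positivity
  have := smul_le_smul_of_nonneg_left (h (n + 1)) (one_div_pos.2 hpos).le
  rw [← Nat.cast_smul_eq_nsmul ℝ, smul_smul] at this
  push_cast at this
  rwa [one_div_mul_cancel hpos.ne', one_smul] at this

/-- No supremum is known to exist, so order continuity is applied to the gaps between upper bounds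
and terms; a gap of small norm controls the tail. -/
theorem cauchySeq_of_monotone_of_le (hX : IsOrderContinuous X) {x : ℕ → X} (hx : Monotone x)
    {b : X} (hb : ∀ n, x n ≤ b) : CauchySeq x := by
  set A : Set X := {a | ∃ z n, (∀ m, x m ≤ z) ∧ a = z - x n} with hA
  have hglb : IsGLB A 0 := by
    constructor
    · rintro _ ⟨z, n, hz, rfl⟩
      exact sub_nonneg.2 (hz n)
    · intro w hw
      -- Subtracting a lower bound of the gaps from an upper bound of `x` leaves an upper bound, so
      -- this can be iterated.
      have key : ∀ k : ℕ, ∀ m, x m ≤ b - k • w := by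
        intro k
        induction k with
        | zero => simpa using hb
        | succ k ih =>
          intro m
          have h2 : w ≤ b - k • w - x m := hw ⟨_, m, ih, rfl⟩
          rw [succ_nsmul, ← sub_sub]
          exact le_sub_comm.1 h2
      exact nonpos_of_nsmul_le fun k => le_sub_comm.1 (key k 0)
  have hdir : DirectedOn (fun x y => y ≤ x) A := by
    rintro _ ⟨z, n, hz, rfl⟩ _ ⟨z', n', hz', rfl⟩
    refine ⟨z ⊓ z' - x (max n n'), ⟨_, _, fun m => le_inf (hz m) (hz' m), rfl⟩, ?_, ?_⟩
    · exact sub_le_sub inf_le_left (hx (le_max_left _ _))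
    · exact sub_le_sub inf_le_right (hx (le_max_right _ _))
  have hnorm := hX A ⟨_, b, 0, hb, rfl⟩ hdir hglb
  rw [Metric.cauchySeq_iff']
  intro δ hδ
  obtain ⟨_, ⟨_, ⟨z, n, hz, rfl⟩, rfl⟩, _, hlt⟩ := hnorm.exists_between hδ
  refine ⟨n, fun m hm => ?_⟩
  rw [dist_eq_norm]
  refine (norm_le_norm_of_abs_le_abs ?_).trans_lt hlt
  rw [abs_of_nonneg (sub_nonneg.2 (hx hm)), abs_of_nonneg (sub_nonneg.2 (hz n))]
  exact sub_le_sub_right (hz m) _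

/-! ### Band projections -/

variable [CompleteSpace X]

/-- The band component of `x` is the limit of `x ⊓ n • u`. -/
theorem exists_principalBand_add_of_nonneg (hX : IsOrderContinuous X) {u x : X} (hu : 0 ≤ u)
    (hx : 0 ≤ x) : ∃ y ∈ principalBand u, ∃ z ∈ disjointComplement {u}, y + z = x := by
  have hmono : Monotone fun n : ℕ => x ⊓ n • u := fun m n hmn =>
    inf_le_inf_left _ (nsmul_le_nsmul_left hu hmn)
  obtain ⟨y, hy⟩ := cauchySeq_tendsto_of_complete
    (cauchySeq_of_monotone_of_le hX hmono (b := x) fun _ => inf_le_left)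
  have hyx : y ≤ x := le_of_tendsto' hy fun _ => inf_le_left
  refine ⟨y, ?_, x - y, ?_, add_sub_cancel y x⟩
  · refine (isClosed_disjointComplement _).mem_of_tendsto hy (.of_forall fun n => ?_)
    refine mem_principalBand.2 fun v hv => (hv.symm.nsmul_left n).mono_left ?_
    have h0 := nsmul_nonneg hu n
    rw [abs_of_nonneg (le_inf hx h0), abs_of_nonneg h0]
    exact inf_le_right
  · have h0 : 0 ≤ x - y := sub_nonneg.2 hyx
    rw [mem_disjointComplement_singleton, isDisjoint_of_nonneg h0 hu]
    refine le_antisymm ?_ (le_inf h0 hu)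
    -- The sum lies below `x ⊓ (n + 1) • u`; letting `n → ∞` leaves `y + (x - y) ⊓ u ≤ y`.
    have h1 : ∀ n : ℕ, x ⊓ n • u + (x - y) ⊓ u ≤ y := fun n => by
      refine le_trans ?_ (hmono.ge_of_tendsto hy (n + 1))
      refine le_inf ?_ ?_
      · have := add_le_add (hmono.ge_of_tendsto hy n) (inf_le_left : (x - y) ⊓ u ≤ x - y)
        simpa using this
      · rw [succ_nsmul]
        exact add_le_add inf_le_right inf_le_right
    have h2 := le_of_tendsto' (hy.add_const ((x - y) ⊓ u)) h1
    simpa using h2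

theorem isCompl_principalBand (hX : IsOrderContinuous X) {u : X} (hu : 0 ≤ u) :
    IsCompl (principalBand u) (disjointComplement {u}) := by
  constructor
  · rw [Submodule.disjoint_def]
    intro x hx hx'
    exact isDisjoint_self.1 (mem_principalBand.1 hx x (mem_disjointComplement_singleton.1 hx'))
  · rw [codisjoint_iff, eq_top_iff]
    intro x _
    rw [← posPart_sub_negPart x]
    exact Submodule.sub_mem _
      (Submodule.mem_sup.2 (exists_principalBand_add_of_nonneg hX hu (posPart_nonneg x)))
      (Submodule.mem_sup.2 (exists_principalBand_add_of_nonneg hX hu (negPart_nonneg x)))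

/-- The band projection onto `u^⊥⊥`. -/
noncomputable def bandProjection (hX : IsOrderContinuous X) {u : X} (hu : 0 ≤ u) : X →ₗ[ℝ] X :=
  (principalBand u).projection (disjointComplement {u}) (isCompl_principalBand hX hu)

section Projection

variable (hX : IsOrderContinuous X) {u : X} (hu : 0 ≤ u)

theorem bandProjection_mem (x : X) : bandProjection hX hu x ∈ principalBand u :=
  Submodule.projection_apply_mem _ x

theorem isDisjoint_sub_bandProjection (x : X) : IsDisjoint (x - bandProjection hX hu x) u :=
  mem_disjointComplement_singleton.1 (Submodule.sub_projection_mem _ x)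

theorem bandProjection_of_mem {x : X} (hx : x ∈ principalBand u) :
    bandProjection hX hu x = x :=
  Submodule.projection_apply_of_mem_left _ hx

theorem isDisjoint_of_bandProjection_eq_zero {x : X} (hx : bandProjection hX hu x = 0) :
    IsDisjoint x u :=
  mem_disjointComplement_singleton.1 ((Submodule.projection_apply_eq_zero_iff _).1 hx)

theorem isDisjoint_bandProjection_sub (x : X) :
    IsDisjoint (bandProjection hX hu x) (x - bandProjection hX hu x) :=
  mem_principalBand.1 (bandProjection_mem hX hu x) _ (isDisjoint_sub_bandProjection hX hu x)

theorem abs_bandProjection_le (x : X) : |bandProjection hX hu x| ≤ |x| := by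
  simpa using (isDisjoint_bandProjection_sub hX hu x).abs_le_abs_add

theorem abs_sub_bandProjection_le (x : X) : |x - bandProjection hX hu x| ≤ |x| := by
  simpa using (isDisjoint_bandProjection_sub hX hu x).symm.abs_le_abs_add

theorem norm_bandProjection_le (x : X) : ‖bandProjection hX hu x‖ ≤ ‖x‖ :=
  norm_le_norm_of_abs_le_abs (abs_bandProjection_le hX hu x)

theorem continuous_bandProjection : Continuous (bandProjection hX hu) :=
  AddMonoidHomClass.continuous_of_bound _ 1 fun x => by
    simpa using norm_bandProjection_le hX hu x

theorem IsEpsBandPreserving.norm_sub_bandProjection_le {ε : ℝ} {T : X →ₗ[ℝ] X}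
    (hT : IsEpsBandPreserving ε T) {x : X} (hx : x ∈ principalBand u) :
    ‖T x - bandProjection hX hu (T x)‖ ≤ ε * ‖x‖ :=
  hT.norm_le (mem_principalBand.1 hx _ (isDisjoint_sub_bandProjection hX hu _)).symm
    (abs_sub_bandProjection_le hX hu _)

theorem IsEpsBandPreserving.norm_bandProjection_le {ε : ℝ} {T : X →ₗ[ℝ] X}
    (hT : IsEpsBandPreserving ε T) {x : X} (hx : IsDisjoint x u) :
    ‖bandProjection hX hu (T x)‖ ≤ ε * ‖x‖ :=
  hT.norm_le (mem_principalBand.1 (bandProjection_mem hX hu _) x hx)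
    (abs_bandProjection_le hX hu _)

end Projection

end BanachLattice

/-! ### Atoms and disjoint sequences -/

namespace BanachLattice

open Filter Topology

/-- A positive element that does not dominate two nonzero disjoint positive elements. -/
def IsDisjointnessAtom {X : Type*} [Lattice X] [AddCommGroup X] (a : X) : Prop :=
  0 < a ∧ ∀ b c, 0 ≤ b → b ≤ a → 0 ≤ c → c ≤ a → b ⊓ c = 0 → b = 0 ∨ c = 0

/-- Split repeatedly into two disjoint pieces: `f` is kept, `g` is split again. Later kept pieces
lie below `g` and so miss the earlier `f`. -/
theorem exists_seq_isDisjoint {X : Type*} [Lattice X] [AddCommGroup X] {v : X}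
    (hv : 0 < v) (h : ∀ a ≤ v, ¬ IsDisjointnessAtom a) :
    ∃ u : ℕ → X, (∀ n, 0 < u n ∧ u n ≤ v) ∧ ∀ m n, m ≠ n → u m ⊓ u n = 0 := by
  have hsplit : ∀ a : {a : X // 0 < a ∧ a ≤ v}, ∃ b c : {a : X // 0 < a ∧ a ≤ v},
      b.1 ≤ a.1 ∧ c.1 ≤ a.1 ∧ b.1 ⊓ c.1 = 0 := by
    rintro ⟨a, ha, hav⟩
    have hna := h a hav
    simp only [IsDisjointnessAtom, not_and, not_forall, not_or] at hna
    obtain ⟨b, c, hb, hba, hc, hca, hbc, hb0, hc0⟩ := hna ha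
    exact ⟨⟨b, hb.lt_of_ne (Ne.symm hb0), hba.trans hav⟩,
      ⟨c, hc.lt_of_ne (Ne.symm hc0), hca.trans hav⟩, hba, hca, hbc⟩
  choose f g hf hg hfg using hsplit
  let s : ℕ → {a : X // 0 < a ∧ a ≤ v} := fun n => g^[n] ⟨v, hv, le_rfl⟩
  have hs : ∀ n, s (n + 1) = g (s n) := fun n => Function.iterate_succ_apply' g n _
  have hanti : Antitone fun n => (s n).1 := antitone_nat_of_succ_le fun n => by
    rw [hs]; exact hg _
  have hlt : ∀ m n, m < n → (f (s m)).1 ⊓ (f (s n)).1 = 0 := fun m n hmn => by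
    refine le_antisymm ?_ (le_inf (f _).2.1.le (f _).2.1.le)
    calc (f (s m)).1 ⊓ (f (s n)).1 ≤ (f (s m)).1 ⊓ (s (m + 1)).1 :=
          inf_le_inf_left _ ((hf _).trans (hanti hmn))
      _ = 0 := by rw [hs, hfg]
  refine ⟨fun n => (f (s n)).1, fun n => (f (s n)).2, fun m n hmn => ?_⟩
  rcases hmn.lt_or_gt with h | h
  · exact hlt m n h
  · rw [inf_comm]; exact hlt n m h

variable {X : Type*} [NormedAddCommGroup X] [NormedSpace ℝ X]
    [Lattice X] [IsOrderedAddMonoid X] [IsOrderedModule ℝ X]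

/-- `z⁺ ⊓ a` and `z⁻ ⊓ a` are disjoint below `a`, so one is zero; the corresponding part of `z` is
then both in the band and disjoint from `a`. -/
theorem IsDisjointnessAtom.nonpos_or_nonneg {a z : X} (ha : IsDisjointnessAtom a)
    (hz : z ∈ principalBand a) : z ≤ 0 ∨ 0 ≤ z := by
  have key : ∀ w : X, 0 ≤ w → |w| ≤ |z| → w ⊓ a = 0 → w = 0 := fun w hw hwz hwa =>
    isDisjoint_self.1 ((mem_principalBand.1 hz w
      ((isDisjoint_of_nonneg hw ha.1.le).2 hwa)).mono_left hwz)
  have hp := posPart_nonneg z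
  have hn := negPart_nonneg z
  have hsum : |z| = z⁺ + z⁻ := (posPart_add_negPart z).symm
  have hpz : |z⁺| ≤ |z| := by
    rw [abs_of_nonneg hp, hsum]; exact le_add_of_nonneg_right hn
  have hnz : |z⁻| ≤ |z| := by
    rw [abs_of_nonneg hn, hsum]; exact le_add_of_nonneg_left hp
  refine (ha.2 (z⁺ ⊓ a) (z⁻ ⊓ a) (le_inf hp ha.1.le) inf_le_right (le_inf hn ha.1.le)
    inf_le_right ?_).imp (fun h => ?_) fun h => ?_
  · refine le_antisymm ?_ (le_inf (le_inf hp ha.1.le) (le_inf hn ha.1.le))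
    rw [← posPart_inf_negPart_eq_zero z]
    exact inf_le_inf inf_le_left inf_le_left
  · exact posPart_eq_zero.1 (key _ hp hpz h)
  · exact negPart_eq_zero.1 (key _ hn hnz h)

variable [HasSolidNorm X]

/-- Each `x - t • a` has a sign, and both signs occur by the Archimedean property; connectedness of
`ℝ` gives a `t` with both. -/
theorem IsDisjointnessAtom.exists_eq_smul {a x : X} (ha : IsDisjointnessAtom a)
    (hx : x ∈ principalBand a) : ∃ t : ℝ, x = t • a := by
  have hmem : ∀ t : ℝ, x - t • a ∈ principalBand a := fun t =>
    Submodule.sub_mem _ hx (Submodule.smul_mem _ _ (self_mem_principalBand a))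
  have hcont : Continuous fun t : ℝ => x - t • a := by fun_prop
  have hnot : ∀ y : X, ¬ ∀ t : ℝ, t • a ≤ y := fun y h =>
    ha.1.not_ge (nonpos_of_nsmul_le fun n => by
      rw [← Nat.cast_smul_eq_nsmul ℝ]; exact h n)
  obtain ⟨t, -, h1, h2⟩ := isPreconnected_closed_iff.1 (isPreconnected_univ (α := ℝ))
    {t | x - t • a ≤ 0} {t | 0 ≤ x - t • a} (isClosed_le hcont continuous_const)
    (isClosed_le continuous_const hcont) (fun t _ => ha.nonpos_or_nonneg (hmem t))
    (by
      by_contra hne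
      refine hnot x fun t => ?_
      refine sub_nonneg.1 ((ha.nonpos_or_nonneg (hmem t)).resolve_left fun h => ?_)
      exact hne ⟨t, trivial, h⟩)
    (by
      by_contra hne
      refine hnot (-x) fun t => ?_
      have := (ha.nonpos_or_nonneg (hmem (-t))).resolve_right fun h => hne ⟨-t, trivial, h⟩
      rw [neg_smul, sub_neg_eq_add] at this
      exact le_neg_iff_add_nonpos_left.2 this)
  exact ⟨t, sub_eq_zero.1 (le_antisymm h1 h2)⟩

/-! ### The separating space is trivial -/

variable [CompleteSpace X]

/-- The separating space of a band preserving operator is invariant under band projections, with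
approximating sequences in the band. -/
theorem IsEpsBandPreserving.exists_seq_principalBand (hX : IsOrderContinuous X) {ε : ℝ}
    {T : X →ₗ[ℝ] X} (hT : IsEpsBandPreserving ε T) {x : ℕ → X} {y : X}
    (hx : Tendsto x atTop (𝓝 0)) (hTx : Tendsto (fun n => T (x n)) atTop (𝓝 y))
    {u : X} (hu : 0 ≤ u) :
    ∃ w : ℕ → X, (∀ n, w n ∈ principalBand u) ∧ Tendsto w atTop (𝓝 0) ∧
      Tendsto (fun n => T (w n)) atTop (𝓝 (bandProjection hX hu y)) := by
  set P := bandProjection hX hu with hP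
  have hw : Tendsto (fun n => P (x n)) atTop (𝓝 0) := by
    have := ((continuous_bandProjection hX hu).tendsto 0).comp hx
    rwa [map_zero] at this
  have hPT : Tendsto (fun n => P (T (x n))) atTop (𝓝 (P y)) :=
    ((continuous_bandProjection hX hu).tendsto y).comp hTx
  have h1 : Tendsto (fun n => T (P (x n)) - P (T (P (x n)))) atTop (𝓝 0) := by
    refine squeeze_zero_norm (fun n => hT.norm_sub_bandProjection_le hX hu
      (bandProjection_mem hX hu (x n))) ?_
    simpa using hw.norm.const_mul ε
  have h2 : Tendsto (fun n => P (T (x n - P (x n)))) atTop (𝓝 0) := by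
    refine squeeze_zero_norm (fun n => hT.norm_bandProjection_le hX hu
      (isDisjoint_sub_bandProjection hX hu (x n))) ?_
    simpa using (hx.sub hw).norm.const_mul ε
  refine ⟨fun n => P (x n), fun n => bandProjection_mem hX hu _, hw, ?_⟩
  -- `T P x = P T x + (T P x - P T P x) - P T (x - P x)`, with the last two terms null.
  have h3 := (hPT.add h1).sub h2
  rw [add_zero, sub_zero] at h3
  refine h3.congr fun n => ?_
  simp only [map_sub]
  abel

/-- Gliding hump: large images on pairwise disjoint bands contradict band preservation. -/
theorem IsEpsBandPreserving.false_of_disjoint_seq (hX : IsOrderContinuous X) {ε : ℝ}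
    (hε : 0 ≤ ε) {T : X →ₗ[ℝ] X} (hT : IsEpsBandPreserving ε T) {u : ℕ → X} (hu : ∀ k, 0 ≤ u k)
    (hdisj : ∀ j k, j ≠ k → u j ⊓ u k = 0) {x : ℕ → X} (hmem : ∀ k, x k ∈ principalBand (u k))
    (hnorm : ∀ k, ‖x k‖ ≤ (1 / 2) ^ k)
    (hlarge : ∀ k : ℕ, (k : ℝ) ≤ ‖bandProjection hX (hu k) (T (x k))‖) : False := by
  have hsum : Summable x :=
    Summable.of_norm_bounded (summable_geometric_of_lt_one (by norm_num) (by norm_num)) hnorm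
  set s := ∑' k, x k with hs
  -- The partial sums without `x k` lie in the closed complement of `u k`.
  have hrest : ∀ k, IsDisjoint (s - x k) (u k) := fun k => by
    rw [← mem_disjointComplement_singleton]
    have ht : Tendsto (fun F : Finset ℕ => ∑ j ∈ F, x j - x k) atTop (𝓝 (s - x k)) :=
      hsum.hasSum.sub_const (x k)
    refine (isClosed_disjointComplement {u k}).mem_of_tendsto ht ?_
    filter_upwards [eventually_ge_atTop {k}] with F hF
    have hk : k ∈ F := by simpa using hF
    rw [← Finset.add_sum_erase F x hk, add_sub_cancel_left]
    refine Submodule.sum_mem _ fun j hj => ?_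
    rw [mem_disjointComplement_singleton]
    refine mem_principalBand.1 (hmem j) _ ?_
    exact (isDisjoint_of_nonneg (hu k) (hu j)).2 (hdisj k j (Finset.ne_of_mem_erase hj).symm)
  obtain ⟨k, hk⟩ := exists_nat_gt (‖T s‖ + ε * (‖s‖ + 1))
  have h1 : ‖bandProjection hX (hu k) (T (s - x k))‖ ≤ ε * ‖s - x k‖ :=
    hT.norm_bandProjection_le hX (hu k) (hrest k)
  have h2 : ‖s - x k‖ ≤ ‖s‖ + 1 :=
    (norm_sub_le _ _).trans (add_le_add_right
      ((hnorm k).trans (pow_le_one₀ (by norm_num) (by norm_num))) _)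
  have h3 : bandProjection hX (hu k) (T (x k)) =
      bandProjection hX (hu k) (T s) - bandProjection hX (hu k) (T (s - x k)) := by
    simp
  have h4 := hlarge k
  rw [h3] at h4
  have h5 := norm_sub_le (bandProjection hX (hu k) (T s)) (bandProjection hX (hu k) (T (s - x k)))
  have h6 := BanachLattice.norm_bandProjection_le hX (hu k) (T s)
  have h7 := mul_le_mul_of_nonneg_left h2 hε
  linarith

/-- The separating space of an `ε`-band preserving operator is trivial. -/
theorem IsEpsBandPreserving.eq_zero_of_tendsto (hX : IsOrderContinuous X) {ε : ℝ} (hε : 0 ≤ ε)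
    {T : X →ₗ[ℝ] X} (hT : IsEpsBandPreserving ε T) {x : ℕ → X} {y : X}
    (hx : Tendsto x atTop (𝓝 0)) (hTx : Tendsto (fun n => T (x n)) atTop (𝓝 y)) : y = 0 := by
  by_contra hy
  have hpos : 0 < |y| := (abs_nonneg y).lt_of_ne fun h => hy (by
    rw [← norm_eq_zero, ← norm_abs_eq_norm, ← h, norm_zero])
  by_cases hatom : ∃ a ≤ |y|, IsDisjointnessAtom a
  · obtain ⟨a, hay, ha⟩ := hatom
    refine not_isDisjoint_of_le_abs ha.1 hay
      (isDisjoint_of_bandProjection_eq_zero hX ha.1.le ?_)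
    obtain ⟨w, hw, hw0, hTw⟩ := hT.exists_seq_principalBand hX hx hTx ha.1.le
    choose t ht using fun n => ha.exists_eq_smul (hw n)
    have hnorm : ‖a‖ ≠ 0 := norm_ne_zero_iff.2 ha.1.ne'
    have ht0 : Tendsto t atTop (𝓝 0) := by
      rw [tendsto_zero_iff_norm_tendsto_zero]
      have := hw0.norm.div_const ‖a‖
      rw [norm_zero, zero_div] at this
      refine this.congr fun n => ?_
      rw [ht n, norm_smul, mul_div_cancel_right₀ _ hnorm]
    refine tendsto_nhds_unique hTw ?_
    have := ht0.smul_const (T a)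
    rw [zero_smul] at this
    refine this.congr fun n => ?_
    rw [ht n, map_smul]
  · push Not at hatom
    obtain ⟨u, hu, hdisj⟩ := exists_seq_isDisjoint hpos hatom
    have hu0 : ∀ k, 0 ≤ u k := fun k => (hu k).1.le
    have hex : ∀ k : ℕ, ∃ z ∈ principalBand (u k), ‖z‖ ≤ (1 / 2) ^ k ∧
        (k : ℝ) ≤ ‖bandProjection hX (hu0 k) (T z)‖ := fun k => by
      obtain ⟨w, hw, hw0, hTw⟩ := hT.exists_seq_principalBand hX hx hTx (hu0 k)
      set z := bandProjection hX (hu0 k) y with hz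
      have hz0 : z ≠ 0 := fun h => not_isDisjoint_of_le_abs (hu k).1 (hu k).2
        (isDisjoint_of_bandProjection_eq_zero hX (hu0 k) h)
      -- The scaled images have limit norm `k + 1`, strictly above the required `k`, so some term
      -- already attains `k`.
      set c : ℝ := (k + 1) / ‖z‖ with hc
      have hcz : ‖c • z‖ = k + 1 := by
        rw [norm_smul, hc, norm_div, norm_norm, div_mul_cancel₀ _ (norm_ne_zero_iff.2 hz0),
          Real.norm_of_nonneg (by positivity)]
      have h1 : Tendsto (fun n => ‖c • w n‖) atTop (𝓝 0) := by
        simpa using (hw0.const_smul c).norm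
      have h2 : Tendsto (fun n => ‖bandProjection hX (hu0 k) (T (c • w n))‖) atTop
          (𝓝 (k + 1)) := by
        have := (((continuous_bandProjection hX (hu0 k)).tendsto _).comp
          (hTw.const_smul c)).norm
        rw [map_smul, bandProjection_of_mem hX (hu0 k) (bandProjection_mem hX (hu0 k) y),
          ← hz, hcz] at this
        exact this.congr fun n => by simp
      obtain ⟨n, hn1, hn2⟩ := ((h1.eventually_le_const (by positivity : (0 : ℝ) < (1 / 2) ^ k)).and
        (h2.eventually_const_le (lt_add_one (k : ℝ)))).exists
      exact ⟨c • w n, Submodule.smul_mem _ _ (hw n), hn1, hn2⟩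
    choose z hz hz1 hz2 using hex
    exact hT.false_of_disjoint_seq hX hε hu0 hdisj hz hz1 hz2

end BanachLattice

theorem corollary3p2 {X : Type*} [NormedAddCommGroup X] [NormedSpace ℝ X] [CompleteSpace X]
    [Lattice X] [IsOrderedAddMonoid X] [IsOrderedModule ℝ X] [HasSolidNorm X]
    (hX : BanachLattice.IsOrderContinuous X) (ε : ℝ) (hε : 0 < ε)
    (T : X →ₗ[ℝ] X) (hT : BanachLattice.IsEpsBandPreserving ε T) :
    Continuous T := by
  refine T.continuous_of_seq_closed_graph fun u x y hu hTu => ?_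
  refine sub_eq_zero.1 (hT.eq_zero_of_tendsto hX hε.le (x := fun n => u n - x) ?_ ?_)
  · simpa using hu.sub_const x
  · simpa using hTu.sub_const (T x)
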